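/- Theorem. Let $(\Omega,\mathcal F,\mu)$ be a semi-finite measure space, i.e. every measurable set of infinite measure contains a measurable subset of finite positive measure. Let $L^0(\mu)$ be the vector lattice of $\mu$-a.e. equivalence classes of real-valued measurable functions on $\Omega$, and let $X$ be an order continuous Banach function space over $\mu$: that is, $X$ is an order ideal of $L^0(\mu)$ (a linear subspace such that $|f|\le |g|$, $g\in X$, $f\in L^0(\mu)$ imply $f\in X$) equipped with a complete norm satisfying $\|f\|\le\|g\|$ whenever $f,g\in X$ and $|f|\le|g|$, and such that every net in $X$ which decreases and has infimum $0$ in $X$ converges to $0$ in norm. Then the following assertions are equivalent: 1. $X$ is separable in its norm topology. 2. $X$ is separable in the topology of local convergence in measure, and $X$ has a carrier $C_X$ which is $\sigma$-finite. Here a carrier of $X$ is a measurable set $C_X\subseteq\Omega$ which is the smallest one, with respect to inclusion up to $\mu$-null sets, such that every $f\in X$ vanishes $\mu$-a.e. on $\Omega\setminus C_X$ (it is unique up to $\mu$-null sets if it exists); it is $\sigma$-finite if the restriction of $\mu$ to $C_X$ is a $\sigma$-finite measure. The topology of local convergence in measure is the topology on $L^0(\mu)$ (restricted to $X$) in which a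 net $(f_\lambda)$ converges to $f$ if and only if $f_\lambda\chi_A\to f\chi_A$ in measure for every measurable set $A$ with $\mu(A)<\infty$. -/

import Mathlib

open MeasureTheory Filter Topology Set TopologicalSpace
open scoped ENNReal

universe u

section FunctionSpaces

/-- A measure is semi-finite if every measurable set of infinite measure has a measurable subset
of finite positive measure. -/
def IsSemifiniteMeasure {Ω : Type u} [MeasurableSpace Ω] (μ : Measure Ω) : Prop :=
  ∀ s : Set Ω, MeasurableSet s → μ s = ∞ →
    ∃ t : Set Ω, t ⊆ s ∧ MeasurableSet t ∧ 0 < μ t ∧ μ t < ∞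

/-- A function space over `μ`: an order ideal (a solid linear subspace) of the vector lattice
`L⁰(μ)` of `μ`-a.e. classes of real measurable functions. -/
structure FunctionSpace {Ω : Type u} [MeasurableSpace Ω] (μ : Measure Ω) where
  toSubmodule : Submodule ℝ (Ω →ₘ[μ] ℝ)
  solid : ∀ f g : Ω →ₘ[μ] ℝ, |f| ≤ |g| → g ∈ toSubmodule → f ∈ toSubmodule

/-- A function space with a lattice norm. The order is the one inherited from `L⁰(μ)`. -/
structure NormedFunctionSpace {Ω : Type u} [MeasurableSpace Ω] (μ : Measure Ω) extends
    FunctionSpace μ where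
  latticeNorm : Seminorm ℝ toSubmodule
  eq_zero_of_latticeNorm : ∀ f : toSubmodule, latticeNorm f = 0 → f = 0
  latticeNorm_mono : ∀ f g : toSubmodule,
    |(f : Ω →ₘ[μ] ℝ)| ≤ |(g : Ω →ₘ[μ] ℝ)| → latticeNorm f ≤ latticeNorm g

/-- The elements of a normed function space, as a type, with the linear and order structure
inherited from `L⁰(μ)`; it carries the norm (topology). -/
def NormedFunctionSpace.Elem {Ω : Type u} [MeasurableSpace Ω] {μ : Measure Ω}
    (X : NormedFunctionSpace μ) : Type u := X.toSubmodule

noncomputable instance NormedFunctionSpace.instAddCommGroup {Ω : Type u} [MeasurableSpace Ω]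
    {μ : Measure Ω} (X : NormedFunctionSpace μ) : AddCommGroup X.Elem :=
  inferInstanceAs (AddCommGroup X.toSubmodule)

noncomputable instance NormedFunctionSpace.instModule {Ω : Type u} [MeasurableSpace Ω]
    {μ : Measure Ω} (X : NormedFunctionSpace μ) : Module ℝ X.Elem :=
  inferInstanceAs (Module ℝ X.toSubmodule)

noncomputable instance NormedFunctionSpace.instPartialOrder {Ω : Type u} [MeasurableSpace Ω]
    {μ : Measure Ω} (X : NormedFunctionSpace μ) : PartialOrder X.Elem :=
  inferInstanceAs (PartialOrder X.toSubmodule)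

noncomputable instance NormedFunctionSpace.instNormedAddCommGroup
    {Ω : Type u} [MeasurableSpace Ω] {μ : Measure Ω} (X : NormedFunctionSpace μ) :
    NormedAddCommGroup X.Elem :=
  AddGroupNorm.toNormedAddCommGroup
    { X.latticeNorm.toAddGroupSeminorm with
      eq_zero_of_map_eq_zero' := X.eq_zero_of_latticeNorm }

theorem NormedFunctionSpace.norm_eq {Ω : Type u} [MeasurableSpace Ω] {μ : Measure Ω}
    (X : NormedFunctionSpace μ) (f : X.Elem) : ‖f‖ = X.latticeNorm f := rfl

noncomputable instance NormedFunctionSpace.instNormedSpace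
    {Ω : Type u} [MeasurableSpace Ω] {μ : Measure Ω} (X : NormedFunctionSpace μ) :
    NormedSpace ℝ X.Elem where
  norm_smul_le c f := (map_smul_eq_mul X.latticeNorm c f).le

/-- The norm is complete. -/
def NormedFunctionSpace.IsComplete {Ω : Type u} [MeasurableSpace Ω] {μ : Measure Ω}
    (X : NormedFunctionSpace μ) : Prop :=
  CompleteSpace X.Elem

/-- A Banach function space: a function space with a complete lattice norm. -/
structure BanachFunctionSpace {Ω : Type u} [MeasurableSpace Ω] (μ : Measure Ω) extends
    NormedFunctionSpace μ where
  complete : toNormedFunctionSpace.IsComplete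

/-- The norm is order continuous: if a net decreases to `0` in `X`, then it converges to `0` in
norm. (Index sets in the universe of `X` suffice, as the terms of a decreasing net form a
downward directed subset of `X`.) -/
def NormedFunctionSpace.IsOrderContinuous {Ω : Type u} [MeasurableSpace Ω] {μ : Measure Ω}
    (X : NormedFunctionSpace μ) : Prop :=
  ∀ (ι : Type u) [Preorder ι] [IsDirectedOrder ι] [Nonempty ι] (x : ι → X.Elem),
    Antitone x → IsGLB (Set.range x) 0 → Tendsto x atTop (𝓝 0)

/-- `C` is (a representative of) the carrier of `X`: the smallest measurable set, with respect to
`μ`-a.e. inclusion, such that every `f ∈ X` vanishes `μ`-a.e. outside it. -/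
def FunctionSpace.IsCarrier {Ω : Type u} [MeasurableSpace Ω] {μ : Measure Ω}
    (X : FunctionSpace μ) (C : Set Ω) : Prop :=
  (MeasurableSet C ∧ ∀ f ∈ X.toSubmodule, ∀ᵐ ω ∂μ, ω ∉ C → f ω = 0) ∧
  ∀ D : Set Ω, MeasurableSet D → (∀ f ∈ X.toSubmodule, ∀ᵐ ω ∂μ, ω ∉ D → f ω = 0) → C ≤ᵐ[μ] D

/-- The basic neighbourhood of `f` for local convergence in measure, for a set `A` (of finite
measure) and `ε > 0`. -/
def localMeasureBall {Ω : Type u} [MeasurableSpace Ω] (μ : Measure Ω)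
    (f : Ω →ₘ[μ] ℝ) (A : Set Ω) (ε : ℝ) : Set (Ω →ₘ[μ] ℝ) :=
  {g | μ (A ∩ {ω | ε ≤ |g ω - f ω|}) < ENNReal.ofReal ε}

theorem localMeasureBall_mono {Ω : Type u} [MeasurableSpace Ω] {μ : Measure Ω}
    (f : Ω →ₘ[μ] ℝ) {A B : Set Ω} (hAB : A ⊆ B) {ε δ : ℝ} (h : ε ≤ δ) :
    localMeasureBall μ f B ε ⊆ localMeasureBall μ f A δ := by
  intro g hg
  refine lt_of_le_of_lt (measure_mono ?_) (lt_of_lt_of_le hg (ENNReal.ofReal_le_ofReal h))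
  rintro ω ⟨h1, h2⟩
  exact ⟨hAB h1, h.trans h2⟩

/-- The topology of local convergence in measure on `L⁰(μ)`. -/
@[reducible]
def localMeasureTopology {Ω : Type u} [MeasurableSpace Ω] (μ : Measure Ω) :
    TopologicalSpace (Ω →ₘ[μ] ℝ) where
  IsOpen U := ∀ f ∈ U, ∃ A : Set Ω, MeasurableSet A ∧ μ A < ∞ ∧
    ∃ ε : ℝ, 0 < ε ∧ localMeasureBall μ f A ε ⊆ U
  isOpen_univ := fun _ _ => ⟨∅, MeasurableSet.empty, by simp, 1, one_pos, subset_univ _⟩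
  isOpen_inter := by
    rintro U V hU hV f ⟨hfU, hfV⟩
    obtain ⟨A, hA, hA', ε, hε, h⟩ := hU f hfU
    obtain ⟨B, hB, hB', δ, hδ, h'⟩ := hV f hfV
    refine ⟨A ∪ B, hA.union hB, measure_union_lt_top hA' hB', min ε δ, lt_min hε hδ, ?_⟩
    exact subset_inter
      ((localMeasureBall_mono f subset_union_left (min_le_left _ _)).trans h)
      ((localMeasureBall_mono f subset_union_right (min_le_right _ _)).trans h')
  isOpen_sUnion := by
    rintro S hS f ⟨U, hU, hf⟩
    obtain ⟨A, hA, hA', ε, hε, h⟩ := hS U hU f hf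
    exact ⟨A, hA, hA', ε, hε, h.trans (subset_sUnion_of_mem hU)⟩

theorem mem_nhds_localMeasureTopology {Ω : Type u} [MeasurableSpace Ω] {μ : Measure Ω}
    (f : Ω →ₘ[μ] ℝ) (U : Set (Ω →ₘ[μ] ℝ)) :
    U ∈ @nhds _ (localMeasureTopology μ) f ↔ ∃ A : Set Ω, MeasurableSet A ∧ μ A < ∞ ∧
      ∃ ε : ℝ, 0 < ε ∧ localMeasureBall μ f A ε ⊆ U := by
  let _ := localMeasureTopology μ
  constructor
  · intro h
    obtain ⟨V, hVU, hV, hfV⟩ := mem_nhds_iff.1 h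
    obtain ⟨A, hA, hA', ε, hε, h⟩ := hV f hfV
    exact ⟨A, hA, hA', ε, hε, h.trans hVU⟩
  · rintro ⟨A, hA, hA', ε, hε, hU⟩
    -- the set of points having a basic neighbourhood inside `U` is open
    refine mem_nhds_iff.2 ⟨{g | ∃ A : Set Ω, MeasurableSet A ∧ μ A < ∞ ∧
      ∃ ε : ℝ, 0 < ε ∧ localMeasureBall μ g A ε ⊆ U}, ?_, ?_, ⟨A, hA, hA', ε, hε, hU⟩⟩
    · rintro g ⟨A, hA, hA', ε, hε, hU⟩
      refine hU ?_
      have : A ∩ {ω | ε ≤ |g ω - g ω|} = ∅ := by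
        ext ω; simp [hε]
      simp only [localMeasureBall, mem_ofPred_eq, this, measure_empty]
      exact ENNReal.ofReal_pos.2 hε
    · rintro g ⟨A, hA, hA', ε, hε, hU⟩
      refine ⟨A, hA, hA', ε / 2, half_pos hε, ?_⟩
      intro h hh
      refine ⟨A, hA, hA', ε / 2, half_pos hε, ?_⟩
      intro k hk
      refine hU ?_
      simp only [localMeasureBall, mem_ofPred_eq] at hh hk ⊢
      calc μ (A ∩ {ω | ε ≤ |k ω - g ω|})
          ≤ μ ((A ∩ {ω | ε / 2 ≤ |k ω - h ω|}) ∪ (A ∩ {ω | ε / 2 ≤ |h ω - g ω|})) := by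
            refine measure_mono ?_
            rintro ω ⟨h1, h2⟩
            simp only [mem_union, mem_inter_iff, h1, true_and, mem_ofPred_eq] at h2 ⊢
            by_contra! hc
            have := abs_sub_le (k ω) (h ω) (g ω)
            linarith [hc.1, hc.2]
        _ ≤ _ := measure_union_le _ _
        _ < ENNReal.ofReal (ε / 2) + ENNReal.ofReal (ε / 2) := ENNReal.add_lt_add hk hh
        _ = ENNReal.ofReal ε := by
            rw [← ENNReal.ofReal_add (half_pos hε).le (half_pos hε).le, add_halves]

/-- Convergence in this topology is convergence in measure on every measurable set of finite
measure. -/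
theorem tendsto_localMeasureTopology_iff {Ω : Type u} [MeasurableSpace Ω] {μ : Measure Ω}
    {ι : Type*} (l : Filter ι) (x : ι → Ω →ₘ[μ] ℝ) (f : Ω →ₘ[μ] ℝ) :
    Tendsto x l (@nhds _ (localMeasureTopology μ) f) ↔
      ∀ A : Set Ω, MeasurableSet A → μ A < ∞ →
        TendstoInMeasure (μ.restrict A) (fun i => (x i : Ω → ℝ)) l f := by
  have key : ∀ (A : Set Ω) (hA : MeasurableSet A) (i : ι) (ε : ℝ),
      μ.restrict A {ω | ε ≤ dist (x i ω) (f ω)} = μ (A ∩ {ω | ε ≤ |x i ω - f ω|}) := by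
    intro A hA i ε
    rw [Measure.restrict_apply' hA, inter_comm]
    rfl
  constructor
  · intro h A hA hA'
    rw [tendstoInMeasure_iff_dist]
    intro ε hε
    rw [ENNReal.tendsto_nhds_zero]
    intro δ hδ
    obtain ⟨η, hη, hηε, hηδ⟩ : ∃ η : ℝ, 0 < η ∧ η ≤ ε ∧ ENNReal.ofReal η ≤ δ := by
      by_cases hd : δ = ∞
      · exact ⟨ε, hε, le_rfl, hd ▸ le_top⟩
      · refine ⟨min ε δ.toReal, lt_min hε (ENNReal.toReal_pos hδ.ne' hd), min_le_left _ _, ?_⟩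
        exact ENNReal.ofReal_le_of_le_toReal (min_le_right _ _)
    have := h ((mem_nhds_localMeasureTopology f _).2 ⟨A, hA, hA', η, hη, subset_rfl⟩)
    filter_upwards [this] with i hi
    rw [key A hA]
    refine (measure_mono ?_).trans ((le_of_lt hi).trans hηδ)
    rintro ω ⟨h1, h2⟩
    exact ⟨h1, hηε.trans h2⟩
  · intro h U hU
    obtain ⟨A, hA, hA', ε, hε, hU⟩ := (mem_nhds_localMeasureTopology f U).1 hU
    have h0 := (tendstoInMeasure_iff_dist.1 (h A hA hA')) ε hε
    change ∀ᶠ i in l, x i ∈ U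
    filter_upwards [h0.eventually_lt_const (ENNReal.ofReal_pos.2 hε)] with i hi
    rw [key A hA] at hi
    exact hU hi

/-- The topology of local convergence in measure on a function space (subspace topology). -/
@[reducible]
def FunctionSpace.localMeasureTopology {Ω : Type u} [MeasurableSpace Ω] {μ : Measure Ω}
    (X : FunctionSpace μ) : TopologicalSpace X.toSubmodule :=
  TopologicalSpace.induced Subtype.val (_root_.localMeasureTopology μ)

end FunctionSpaces

/-! From norm to measure: completeness makes the tail sums of a norm-summable sequence available in
$X$. They dominate the terms pointwise and have norms tending to 0, so the terms tend to 0 a.e. Fast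
norm approximation is therefore a.e. approximation, hence approximation in measure on sets of finite
measure (`separableSpace_localMeasure`). The supports of a dense sequence make up the carrier. Each
is σ-finite up to a null set: by semi-finiteness $|f|\chi_{A^c}$ decreases to 0 as $A$ grows through
the sets of finite measure, and order continuity extracts countably many $A$
(`exists_finite_cover_support`).

From measure to norm: on a σ-finite carrier, Borel–Cantelli turns approximation in measure by a
sequence $d$ into a.e. convergence of chosen terms. Truncating at levels $s_k \in X$ built from $d$
supplies dominants, so dominated convergence, a consequence of order continuity, gives norm
convergence (`separableSpace_of_localMeasure`). -/

namespace NormedFunctionSpace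

/-! ### Pointwise a.e. description of order, norm and membership -/

variable {Ω : Type u} [MeasurableSpace Ω] {μ : Measure Ω} (X : NormedFunctionSpace μ)

/-- The inclusion of a normed function space into `L⁰(μ)`. -/
def toAE : X.Elem →ₗ[ℝ] (Ω →ₘ[μ] ℝ) := X.toSubmodule.subtype

variable {X}

theorem toAE_mem (f : X.Elem) : X.toAE f ∈ X.toSubmodule := Subtype.property f

theorem exists_toAE_eq {f : Ω →ₘ[μ] ℝ} (hf : f ∈ X.toSubmodule) : ∃ x : X.Elem, X.toAE x = f :=
  ⟨⟨f, hf⟩, rfl⟩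

theorem coeFn_sub (f g : X.Elem) : X.toAE (f - g) =ᵐ[μ] fun ω => X.toAE f ω - X.toAE g ω := by
  rw [map_sub]
  exact AEEqFun.coeFn_sub _ _

theorem coeFn_zero : X.toAE 0 =ᵐ[μ] fun _ => (0 : ℝ) := by
  rw [map_zero]
  exact AEEqFun.coeFn_zero

theorem coeFn_sum {ι : Type*} (s : Finset ι) (f : ι → X.Elem) :
    X.toAE (∑ i ∈ s, f i) =ᵐ[μ] fun ω => ∑ i ∈ s, X.toAE (f i) ω := by
  rw [map_sum]
  exact AEEqFun.coeFn_fun_finsetSum _ _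

theorem coeFn_smul (c : ℝ) (f : X.Elem) : X.toAE (c • f) =ᵐ[μ] fun ω => c * X.toAE f ω := by
  rw [map_smul]
  exact AEEqFun.coeFn_smul _ _

theorem le_iff_ae_le {f g : X.Elem} : f ≤ g ↔ ∀ᵐ ω ∂μ, X.toAE f ω ≤ X.toAE g ω :=
  (AEEqFun.coeFn_le (f := X.toAE f) (g := X.toAE g)).symm

theorem abs_toAE_le_iff {f g : Ω →ₘ[μ] ℝ} : |f| ≤ |g| ↔ ∀ᵐ ω ∂μ, |f ω| ≤ |g ω| := by
  rw [← AEEqFun.coeFn_le]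
  apply eventually_congr
  filter_upwards [AEEqFun.coeFn_abs f, AEEqFun.coeFn_abs g] with ω h1 h2
  rw [h1, h2]

theorem norm_le_norm_of_ae_le {f g : X.Elem} (h : ∀ᵐ ω ∂μ, |X.toAE f ω| ≤ |X.toAE g ω|) :
    ‖f‖ ≤ ‖g‖ :=
  X.latticeNorm_mono f g (abs_toAE_le_iff.2 h)

/-- Measurable functions dominated by an element of the space belong to the space. -/
theorem exists_elem_of_ae_le {φ : Ω → ℝ} (hφ : AEMeasurable φ μ) (g : X.Elem)
    (h : ∀ᵐ ω ∂μ, |φ ω| ≤ |X.toAE g ω|) : ∃ f : X.Elem, X.toAE f =ᵐ[μ] φ := by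
  have e := AEEqFun.coeFn_mk φ hφ.aestronglyMeasurable
  have hm : AEEqFun.mk φ hφ.aestronglyMeasurable ∈ X.toSubmodule := by
    refine X.solid _ _ (abs_toAE_le_iff.2 ?_) (toAE_mem g)
    filter_upwards [e, h] with ω h1 h2
    rwa [h1]
  obtain ⟨x, hx⟩ := exists_toAE_eq hm
  exact ⟨x, hx ▸ e⟩

theorem measurable_toAE (f : X.Elem) : Measurable (X.toAE f) :=
  (X.toAE f).measurable

theorem ae_eq_zero_of_norm_eq_zero {f : X.Elem} (h : ‖f‖ = 0) : ∀ᵐ ω ∂μ, X.toAE f ω = 0 := by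
  rw [norm_eq_zero] at h
  subst h
  exact coeFn_zero

/-- A function dominated by elements of arbitrarily small norm vanishes. -/
theorem ae_eq_zero_of_forall_exists {φ : Ω → ℝ} (hφ : AEMeasurable φ μ)
    (h : ∀ ε > 0, ∃ g : X.Elem, ‖g‖ ≤ ε ∧ ∀ᵐ ω ∂μ, |φ ω| ≤ |X.toAE g ω|) :
    ∀ᵐ ω ∂μ, φ ω = 0 := by
  obtain ⟨g, -, hg⟩ := h 1 one_pos
  obtain ⟨f, hf⟩ := exists_elem_of_ae_le hφ g hg
  have : ‖f‖ = 0 := by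
    refine le_antisymm (le_of_forall_pos_le_add fun ε hε => ?_) (norm_nonneg _)
    obtain ⟨g, hg, hg'⟩ := h ε hε
    rw [zero_add]
    refine (norm_le_norm_of_ae_le ?_).trans hg
    filter_upwards [hf, hg'] with ω h1 h2
    rwa [h1]
  filter_upwards [hf, ae_eq_zero_of_norm_eq_zero this] with ω h1 h2
  rw [← h1, h2]

theorem exists_abs (f : X.Elem) : ∃ a : X.Elem, X.toAE a =ᵐ[μ] fun ω => |X.toAE f ω| :=
  exists_elem_of_ae_le (measurable_toAE f).abs.aemeasurable f (by simp)

/-! ### From norm convergence to a.e. convergence -/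

/-- The lower bounds of a norm convergent sequence are lower bounds of its limit. -/
theorem ae_le_of_tendsto {x : ℕ → X.Elem} {y z : X.Elem} (hx : Tendsto x atTop (𝓝 z))
    (h : ∀ᶠ n in atTop, ∀ᵐ ω ∂μ, X.toAE y ω ≤ X.toAE (x n) ω) :
    ∀ᵐ ω ∂μ, X.toAE y ω ≤ X.toAE z ω := by
  have := ae_eq_zero_of_forall_exists (X := X)
    -- The positive part of $y - z$ is dominated by $|x_n - z|$, whose norm is eventually small.
    (φ := fun ω => max (X.toAE y ω - X.toAE z ω) 0)
    (((measurable_toAE y).sub (measurable_toAE z)).max measurable_const).aemeasurable ?_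
  · filter_upwards [this] with ω h
    have := le_max_left (X.toAE y ω - X.toAE z ω) 0
    linarith
  · intro ε hε
    obtain ⟨n, hn, hn'⟩ := (h.and (Metric.tendsto_nhds.1 hx ε hε)).exists
    refine ⟨x n - z, by rw [← dist_eq_norm]; exact hn'.le, ?_⟩
    filter_upwards [hn, coeFn_sub (x n) z] with ω h1 h2
    rw [h2, abs_of_nonneg (le_max_right _ _)]
    exact max_le (le_trans (by linarith) (le_abs_self _)) (abs_nonneg _)

/-- In a Banach function space, norm summable sequences converge to `0` almost everywhere. -/
theorem ae_tendsto_zero_of_summable_norm (hX : X.IsComplete) {x : ℕ → X.Elem}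
    (hx : Summable fun n => ‖x n‖) :
    ∀ᵐ ω ∂μ, Tendsto (fun n => X.toAE (x n) ω) atTop (𝓝 0) := by
  have : CompleteSpace X.Elem := hX
  choose a ha using fun n => exists_abs (x n)
  have hle : ∀ n, ‖a n‖ ≤ ‖x n‖ := fun n => norm_le_norm_of_ae_le <| by
    filter_upwards [ha n] with ω h
    rw [h, abs_abs]
  have hsum : Summable a := .of_norm_bounded hx hle
  -- The tail sum from $N$ bounds every $|x_n|$ with $n \ge N$, so it suffices that the infimum over
  -- $N$ of these tails vanishes a.e.
  set G : ℕ → X.Elem := fun N => ∑' i, a (i + N) with hG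
  have hG0 : Tendsto G atTop (𝓝 0) := tendsto_sum_nat_add a
  have hdom : ∀ N m, ∀ᵐ ω ∂μ, X.toAE (a (m + N)) ω ≤ X.toAE (G N) ω := by
    intro N m
    refine ae_le_of_tendsto (((summable_nat_add_iff N).2 hsum).hasSum.tendsto_sum_nat) ?_
    filter_upwards [eventually_gt_atTop m] with n hn
    filter_upwards [coeFn_sum (Finset.range n) (fun i => a (i + N)), ae_all_iff.2 ha] with ω h1 h2
    rw [h1]
    refine Finset.single_le_sum (f := fun i => X.toAE (a (i + N)) ω) (fun i _ => ?_)
      (Finset.mem_range.2 hn)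
    simp only [h2, abs_nonneg]
  have hinf : ∀ᵐ ω ∂μ, ⨅ N, |X.toAE (G N) ω| = 0 := by
    have hbdd : ∀ ω, BddBelow (range fun N => |X.toAE (G N) ω|) := fun ω =>
      ⟨0, by rintro _ ⟨N, rfl⟩; exact abs_nonneg _⟩
    refine ae_eq_zero_of_forall_exists (X := X)
      (Measurable.iInf fun N => (measurable_toAE (G N)).abs).aemeasurable ?_
    intro ε hε
    obtain ⟨N, hN⟩ := (Metric.tendsto_nhds.1 hG0 ε hε).exists
    refine ⟨G N, by rw [← dist_zero_right]; exact hN.le, .of_forall fun ω => ?_⟩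
    rw [abs_of_nonneg (Real.iInf_nonneg fun _ => abs_nonneg _)]
    exact ciInf_le (hbdd ω) N
  filter_upwards [hinf, ae_all_iff.2 ha, ae_all_iff.2 fun N => ae_all_iff.2 (hdom N)]
    with ω h1 h2 h3
  rw [Metric.tendsto_atTop]
  intro ε hε
  obtain ⟨N, hN⟩ := exists_lt_of_ciInf_lt (h1.trans_lt hε)
  refine ⟨N, fun n hn => ?_⟩
  have := h3 N (n - N)
  rw [Nat.sub_add_cancel hn, h2] at this
  rw [dist_zero_right, Real.norm_eq_abs]
  exact (this.trans (le_abs_self _)).trans_lt hN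

/-! ### Consequences of order continuity -/

/-- An order continuous norm satisfies the dominated convergence theorem. -/
theorem IsOrderContinuous.tendsto_zero_of_dominated (hX : X.IsOrderContinuous) {x : ℕ → X.Elem}
    {g : X.Elem} (hg : ∀ n, ∀ᵐ ω ∂μ, |X.toAE (x n) ω| ≤ |X.toAE g ω|)
    (hx : ∀ᵐ ω ∂μ, Tendsto (fun n => X.toAE (x n) ω) atTop (𝓝 0)) :
    Tendsto x atTop (𝓝 0) := by
  -- The tail suprema turn a dominated sequence into a decreasing one. Where they are unbounded the
  -- real supremum is 0, so nonnegativity holds everywhere while monotonicity needs boundedness.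
  set s : ℕ → Ω → ℝ := fun n ω => ⨆ m, |X.toAE (x (m + n)) ω| with hs
  have hs0 : ∀ n ω, 0 ≤ s n ω := fun n ω => Real.iSup_nonneg fun _ => abs_nonneg _
  have hg' := ae_all_iff.2 hg
  have hbdd : ∀ᵐ ω ∂μ, ∀ n, BddAbove (range fun m => |X.toAE (x (m + n)) ω|) := by
    filter_upwards [hg'] with ω h n
    exact ⟨|X.toAE g ω|, by rintro _ ⟨N, rfl⟩; exact h _⟩
  have hex : ∀ n, ∃ y : X.Elem, X.toAE y =ᵐ[μ] s n := by
    intro n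
    refine exists_elem_of_ae_le
      (Measurable.iSup fun m => (measurable_toAE (x (m + n))).abs).aemeasurable g ?_
    filter_upwards [hg'] with ω h
    rw [abs_of_nonneg (hs0 n ω)]
    exact ciSup_le fun m => h _
  choose y hy using hex
  have hy' := ae_all_iff.2 hy
  have hanti : ∀ ω, (∀ n, BddAbove (range fun m => |X.toAE (x (m + n)) ω|)) →
      ∀ i j, i ≤ j → s j ω ≤ s i ω := by
    intro ω h i j hij
    refine ciSup_le fun m => ?_
    have := le_ciSup (h i) (m + (j - i))
    rwa [add_assoc, Nat.sub_add_cancel hij] at this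
  have hlim : ∀ᵐ ω ∂μ, ∀ ε > 0, ∃ n, s n ω ≤ ε := by
    filter_upwards [hx] with ω h ε hε
    obtain ⟨N, hN⟩ := Metric.tendsto_atTop.1 h ε hε
    refine ⟨N, ciSup_le fun m => ?_⟩
    have := hN (m + N) (by omega)
    rw [dist_zero_right, Real.norm_eq_abs] at this
    exact this.le
  -- `ULift` puts the index set in the universe required by `IsOrderContinuous`.
  have key : Tendsto (fun i : ULift.{u} ℕ => y i.down) atTop (𝓝 0) := by
    refine hX (ULift.{u} ℕ) (fun i => y i.down) ?_ ⟨?_, ?_⟩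
    · intro i j hij
      rw [le_iff_ae_le]
      filter_upwards [hy', hbdd] with ω h1 h2
      rw [h1, h1]
      exact hanti ω h2 _ _ hij
    · rintro _ ⟨i, rfl⟩
      rw [le_iff_ae_le]
      filter_upwards [hy', coeFn_zero (X := X)] with ω h1 h2
      rw [h1, h2]
      exact hs0 _ _
    · intro z hz
      have hz' : ∀ n, ∀ᵐ ω ∂μ, X.toAE z ω ≤ X.toAE (y n) ω := fun n =>
        le_iff_ae_le.1 (hz ⟨⟨n⟩, rfl⟩)
      rw [le_iff_ae_le]
      filter_upwards [hy', coeFn_zero (X := X), hlim, ae_all_iff.2 hz'] with ω h1 h2 h3 h4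
      rw [h2]
      refine le_of_forall_pos_le_add fun ε hε => ?_
      obtain ⟨n, hn⟩ := h3 ε hε
      rw [zero_add]
      exact (h4 n).trans ((h1 n).trans_le hn)
  have hup : Tendsto (fun n : ℕ => (⟨n⟩ : ULift.{u} ℕ)) atTop atTop :=
    tendsto_atTop_atTop.2 fun b => ⟨b.down, fun a h => h⟩
  have hy0 := (key.comp hup).norm
  rw [norm_zero] at hy0
  refine squeeze_zero_norm (fun n => ?_) hy0
  refine norm_le_norm_of_ae_le (g := y n) ?_
  filter_upwards [hy', hbdd] with ω h1 h2
  rw [h1]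
  refine le_trans ?_ (le_abs_self _)
  have := le_ciSup (h2 n) 0
  rwa [zero_add] at this

/-- Dominated convergence to an arbitrary limit. -/
theorem IsOrderContinuous.tendsto_of_dominated (hX : X.IsOrderContinuous) {x : ℕ → X.Elem}
    {f g : X.Elem} (hg : ∀ n, ∀ᵐ ω ∂μ, |X.toAE (x n) ω - X.toAE f ω| ≤ |X.toAE g ω|)
    (hx : ∀ᵐ ω ∂μ, Tendsto (fun n => X.toAE (x n) ω) atTop (𝓝 (X.toAE f ω))) :
    Tendsto x atTop (𝓝 f) := by
  rw [← tendsto_sub_nhds_zero_iff]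
  refine hX.tendsto_zero_of_dominated (g := g) (fun n => ?_) ?_
  · filter_upwards [hg n, coeFn_sub (x n) f] with ω h1 h2
    rwa [h2]
  · filter_upwards [hx, ae_all_iff.2 fun n => coeFn_sub (x n) f] with ω h1 h2
    simp only [h2]
    exact tendsto_sub_nhds_zero_iff.2 h1

/-- If `μ` is semi-finite and the norm is order continuous, the elements of the space have
`σ`-finite support. -/
theorem IsOrderContinuous.exists_finite_cover_support (hμ : IsSemifiniteMeasure μ)
    (hX : X.IsOrderContinuous) (f : X.Elem) :
    ∃ A : ℕ → Set Ω, (∀ n, MeasurableSet (A n)) ∧ (∀ n, μ (A n) < ∞) ∧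
      ∀ᵐ ω ∂μ, X.toAE f ω ≠ 0 → ω ∈ ⋃ n, A n := by
  let I : Type u := {A : Set Ω // MeasurableSet A ∧ μ A < ∞}
  have : Nonempty I := ⟨⟨∅, .empty, by simp⟩⟩
  have : IsDirectedOrder I := ⟨fun A B => ⟨⟨A.1 ∪ B.1, A.2.1.union B.2.1,
    measure_union_lt_top A.2.2 B.2.2⟩, subset_union_left, subset_union_right⟩⟩
  have hm : ∀ A : I, Measurable (A.1ᶜ.indicator fun ω => |X.toAE f ω|) := fun A =>
    (measurable_toAE f).abs.indicator A.2.1.compl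
  have hex : ∀ A : I, ∃ y : X.Elem, X.toAE y =ᵐ[μ] A.1ᶜ.indicator fun ω => |X.toAE f ω| := by
    refine fun A => exists_elem_of_ae_le (hm A).aemeasurable f (.of_forall fun ω => ?_)
    by_cases h : ω ∈ A.1 <;> simp [h]
  choose y hy using hex
  have key : Tendsto y atTop (𝓝 0) := by
    refine hX I y ?_ ⟨?_, ?_⟩
    · intro A B hAB
      rw [le_iff_ae_le]
      filter_upwards [hy A, hy B] with ω h1 h2
      rw [h1, h2]
      exact indicator_le_indicator_of_subset (compl_subset_compl.2 hAB) (fun _ => abs_nonneg _) _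
    · rintro _ ⟨A, rfl⟩
      rw [le_iff_ae_le]
      filter_upwards [hy A, coeFn_zero (X := X)] with ω h1 h2
      rw [h1, h2]
      exact indicator_nonneg (fun _ _ => abs_nonneg _) _
    · intro z hz
      have hz' : ∀ A : I, ∀ᵐ ω ∂μ, ω ∈ A.1 → X.toAE z ω ≤ 0 := by
        intro A
        filter_upwards [le_iff_ae_le.1 (hz ⟨A, rfl⟩), hy A] with ω h1 h2 h3
        simpa [h2, h3] using h1
      have hzm : MeasurableSet {ω | 0 < X.toAE z ω} :=
        measurableSet_lt measurable_const (measurable_toAE z)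
      -- A non-null set where $z > 0$ would contain a set of finite positive measure, on which $z
      -- \le 0$ a.e.
      have hnull : μ {ω | 0 < X.toAE z ω} = 0 := by
        by_contra h0
        obtain ⟨B, hBs, hBm, hB0, hB⟩ : ∃ B ⊆ {ω | 0 < X.toAE z ω},
            MeasurableSet B ∧ 0 < μ B ∧ μ B < ∞ := by
          rcases eq_or_ne (μ {ω | 0 < X.toAE z ω}) ∞ with h | h
          · exact hμ _ hzm h
          · exact ⟨_, subset_rfl, hzm, pos_iff_ne_zero.2 h0, h.lt_top⟩
        refine hB0.ne' (measure_mono_null ?_ (hz' ⟨B, hBm, hB⟩))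
        intro ω hω h
        exact absurd (h hω) (not_le.2 (hBs hω))
      rw [le_iff_ae_le]
      filter_upwards [measure_eq_zero_iff_ae_notMem.1 hnull, coeFn_zero (X := X)] with ω h1 h2
      rw [h2]
      exact not_lt.1 h1
  have hA : ∀ n : ℕ, ∃ A : I, ‖y A‖ < 1 / ((n : ℝ) + 1) := fun n => by
    obtain ⟨A, hA⟩ := (Metric.tendsto_nhds.1 key _ (Nat.one_div_pos_of_nat (α := ℝ))).exists
    exact ⟨A, by rwa [dist_zero_right] at hA⟩
  choose A hA using hA
  refine ⟨fun n => (A n).1, fun n => (A n).2.1, fun n => (A n).2.2, ?_⟩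
  -- Off the union of the chosen sets, $|f|$ lies below every $|f|\chi_{A_n^c}$, and these have norm
  -- below $1/(n+1)$.
  have := ae_eq_zero_of_forall_exists (X := X)
    (φ := (⋃ n, (A n).1)ᶜ.indicator fun ω => |X.toAE f ω|)
    ((measurable_toAE f).abs.indicator (MeasurableSet.iUnion fun n => (A n).2.1).compl).aemeasurable
    ?_
  · filter_upwards [this] with ω h hne
    by_contra hc
    rw [indicator_of_mem (mem_compl hc)] at h
    exact hne (abs_eq_zero.1 h)
  · intro ε hε
    obtain ⟨n, hn⟩ := exists_nat_one_div_lt hε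
    refine ⟨y (A n), ((hA n).trans hn).le, ?_⟩
    filter_upwards [hy (A n)] with ω h
    rw [h, abs_of_nonneg (indicator_nonneg (fun _ _ => abs_nonneg _) _),
      abs_of_nonneg (indicator_nonneg (fun _ _ => abs_nonneg _) _)]
    exact indicator_le_indicator_of_subset
      (compl_subset_compl.2 (subset_iUnion (fun n => (A n).1) n)) (fun _ => abs_nonneg _) _

/-! ### Norm separability: carrier and density in measure -/

/-- The union of the supports of a norm dense sequence is a carrier. -/
theorem isCarrier_iUnion_support {d : ℕ → X.Elem} (hd : DenseRange d) :
    X.IsCarrier (⋃ n, {ω | X.toAE (d n) ω ≠ 0}) := by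
  have hC : MeasurableSet (⋃ n, {ω | X.toAE (d n) ω ≠ 0}) := .iUnion fun n =>
    (measurableSet_eq_fun (measurable_toAE (d n)) measurable_const).compl
  refine ⟨⟨hC, fun f hf => ?_⟩, fun D _ h => ?_⟩
  · obtain ⟨f, rfl⟩ := exists_toAE_eq hf
    have := ae_eq_zero_of_forall_exists (X := X)
      (φ := (⋃ n, {ω | X.toAE (d n) ω ≠ 0})ᶜ.indicator (X.toAE f))
      ((measurable_toAE f).indicator hC.compl).aemeasurable ?_
    · filter_upwards [this] with ω h hω
      rwa [indicator_of_mem (mem_compl hω)] at h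
    · intro ε hε
      obtain ⟨n, hn⟩ := hd.exists_dist_lt f hε
      refine ⟨f - d n, by rw [← dist_eq_norm]; exact hn.le, ?_⟩
      filter_upwards [coeFn_sub f (d n)] with ω h
      -- Off all the supports $d_n$ vanishes, so there $|f| = |f - d_n|$.
      by_cases hω : ω ∈ ⋃ n, {ω | X.toAE (d n) ω ≠ 0}
      · rw [indicator_of_notMem (notMem_compl_iff.2 hω), abs_zero]
        exact abs_nonneg _
      · rw [indicator_of_mem (mem_compl hω), h]
        simp only [mem_iUnion, mem_ofPred_eq, not_exists, not_not] at hω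
        rw [hω n, sub_zero]
  · filter_upwards [ae_all_iff.2 fun n => h _ (toAE_mem (d n))] with ω h1 h2
    obtain ⟨n, hn⟩ := mem_iUnion.1 h2
    by_contra hD
    exact hn (h1 n hD)

theorem separableSpace_localMeasure (hX : X.IsComplete) [SeparableSpace X.Elem] :
    @SeparableSpace X.toSubmodule X.localMeasureTopology := by
  let _ := X.localMeasureTopology
  let _ := _root_.localMeasureTopology μ
  let d : ℕ → X.Elem := denseSeq X.Elem
  have hd : DenseRange d := denseRange_denseSeq _
  refine ⟨range fun n => (⟨X.toAE (d n), toAE_mem _⟩ : X.toSubmodule), countable_range _, ?_⟩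
  rintro ⟨f, hf⟩
  obtain ⟨f, rfl⟩ := exists_toAE_eq hf
  -- The geometric rate makes the errors summable, which is what yields a.e. convergence.
  choose k hk using fun n : ℕ => hd.exists_dist_lt f (pow_pos (one_half_pos (α := ℝ)) n)
  have hs : Summable fun n => ‖d (k n) - f‖ := by
    refine .of_nonneg_of_le (fun _ => norm_nonneg _) (fun n => ?_) summable_geometric_two
    rw [← dist_eq_norm, dist_comm]
    exact (hk n).le
  have hae : ∀ᵐ ω ∂μ, Tendsto (fun n => X.toAE (d (k n)) ω) atTop (𝓝 (X.toAE f ω)) := by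
    filter_upwards [ae_tendsto_zero_of_summable_norm hX hs,
      ae_all_iff.2 fun n => coeFn_sub (d (k n)) f] with ω h1 h2
    simp only [h2] at h1
    exact tendsto_sub_nhds_zero_iff.1 h1
  have ht : Tendsto (fun n => X.toAE (d (k n))) atTop (𝓝 (X.toAE f)) := by
    rw [tendsto_localMeasureTopology_iff]
    intro A hA hA'
    have : IsFiniteMeasure (μ.restrict A) := ⟨by simpa using hA'⟩
    exact tendstoInMeasure_of_tendsto_ae
      (fun n => (measurable_toAE (d (k n))).aestronglyMeasurable) (ae_restrict_of_ae hae)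
  have hind : IsInducing (Subtype.val : X.toSubmodule → Ω →ₘ[μ] ℝ) := ⟨rfl⟩
  refine mem_closure_of_tendsto (b := atTop)
    (f := fun n => (⟨X.toAE (d (k n)), toAE_mem _⟩ : X.toSubmodule))
    (hind.tendsto_nhds_iff.2 ht) (.of_forall fun n => ⟨k n, rfl⟩)

/-! ### From separability in measure to norm separability -/

/-- On a `σ`-finite set, points approximable locally in measure are a.e. limits of sequences. -/
theorem exists_seq_ae_tendsto_of_localMeasure {C : Set Ω} (hC : MeasurableSet C)
    [SigmaFinite (μ.restrict C)] {d : ℕ → Ω →ₘ[μ] ℝ} {f : Ω →ₘ[μ] ℝ}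
    (hd : ∀ A, MeasurableSet A → μ A < ∞ → ∀ ε > 0, ∃ n, d n ∈ localMeasureBall μ f A ε) :
    ∃ k : ℕ → ℕ, ∀ᵐ ω ∂μ, ω ∈ C → Tendsto (fun n => d (k n) ω) atTop (𝓝 (f ω)) := by
  set S := spanningSets (μ.restrict C)
  have hfin : ∀ n, μ (S n ∩ C) < ∞ := fun n => by
    rw [← Measure.restrict_apply (measurableSet_spanningSets _ n)]
    exact measure_spanningSets_lt_top _ n
  -- $2^{-n}$ is both the error threshold and the bound on the exceptional measure, so
  -- Borel–Cantelli applies.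
  choose k hk using fun n : ℕ => hd (S n ∩ C) ((measurableSet_spanningSets _ n).inter hC) (hfin n)
    ((1 / 2 : ℝ) ^ n) (by positivity)
  have hsum : ∑' n, μ ((S n ∩ C) ∩ {ω | (1 / 2 : ℝ) ^ n ≤ |d (k n) ω - f ω|}) ≠ ∞ := by
    refine ne_top_of_le_ne_top ?_ (ENNReal.tsum_le_tsum fun n => (hk n).le)
    rw [← ENNReal.ofReal_tsum_of_nonneg (fun n => by positivity) summable_geometric_two]
    exact ENNReal.ofReal_ne_top
  refine ⟨k, ?_⟩
  filter_upwards [ae_eventually_notMem hsum] with ω h hω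
  have hmem : ∀ᶠ n in atTop, ω ∈ S n := by
    obtain ⟨m, hm⟩ := mem_iUnion.1 ((iUnion_spanningSets (μ.restrict C)).symm ▸ mem_univ ω)
    filter_upwards [eventually_ge_atTop m] with n hn
    exact monotone_spanningSets _ hn hm
  rw [← tendsto_sub_nhds_zero_iff]
  refine squeeze_zero_norm' ?_
    (tendsto_pow_atTop_nhds_zero_of_lt_one (by norm_num : (0 : ℝ) ≤ 1 / 2) (by norm_num))
  filter_upwards [h, hmem] with n h1 h2
  by_contra hc
  exact h1 ⟨⟨h2, hω⟩, (not_le.1 hc).le⟩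

theorem exists_localMeasure_dense_seq (h : @SeparableSpace X.toSubmodule X.localMeasureTopology) :
    ∃ d : ℕ → X.Elem, ∀ (f : X.Elem) (A : Set Ω), MeasurableSet A → μ A < ∞ → ∀ ε > 0,
      ∃ n, X.toAE (d n) ∈ localMeasureBall μ (X.toAE f) A ε := by
  let _ := _root_.localMeasureTopology μ
  let _ := X.localMeasureTopology
  have hd := denseRange_denseSeq X.toSubmodule
  refine ⟨denseSeq X.toSubmodule, fun f A hA hA' ε hε => ?_⟩
  have hn : Subtype.val ⁻¹' localMeasureBall μ (X.toAE f) A ε ∈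
      𝓝 (show X.toSubmodule from f) := by
    rw [nhds_induced]
    exact preimage_mem_comap ((mem_nhds_localMeasureTopology _ _).2
      ⟨A, hA, hA', ε, hε, subset_rfl⟩)
  obtain ⟨_, hx, n, rfl⟩ := mem_closure_iff_nhds.1 (hd _) _ hn
  exact ⟨n, hx⟩

/-- The truncations of the $d_n$ at the levels $s_k$ form a countable dense set: for fixed $k$ their
closure contains the truncation of each $f$ at $s_k$, and these tend to $f$ as $k \to \infty$. -/
theorem separableSpace_of_localMeasure (hX : X.IsOrderContinuous) {C : Set Ω}
    (hC : X.IsCarrier C) [SigmaFinite (μ.restrict C)]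
    (h : @SeparableSpace X.toSubmodule X.localMeasureTopology) : SeparableSpace X.Elem := by
  obtain ⟨d, hd⟩ := exists_localMeasure_dense_seq h
  choose a ha using fun n => exists_abs (d n)
  -- The factor $k$ forces $s_k \to \infty$ wherever some $d_i$ is nonzero.
  set s : ℕ → Ω → ℝ := fun k ω => k * ∑ i ∈ Finset.range k, |X.toAE (d i) ω| with hs
  have hs0 : ∀ k ω, 0 ≤ s k ω := fun k ω =>
    mul_nonneg k.cast_nonneg (Finset.sum_nonneg fun _ _ => abs_nonneg _)
  have hsm : ∀ k, Measurable (s k) := fun k =>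
    (Finset.measurable_sum _ fun i _ => (measurable_toAE (d i)).abs).const_mul _
  obtain ⟨e, he⟩ : ∃ e : ℕ → X.Elem, ∀ k, X.toAE (e k) =ᵐ[μ] s k := by
    refine ⟨fun k => (k : ℝ) • ∑ i ∈ Finset.range k, a i, fun k => ?_⟩
    filter_upwards [coeFn_smul (k : ℝ) (∑ i ∈ Finset.range k, a i),
      coeFn_sum (Finset.range k) a, ae_all_iff.2 ha] with ω h1 h2 h3
    rw [h1, h2]
    simp only [h3, hs]
  have habs : ∀ t r : ℝ, 0 ≤ r → |max (-r) (min t r)| ≤ r := fun t r hr =>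
    abs_le.2 ⟨le_max_left _ _, max_le (by linarith) (min_le_right _ _)⟩
  have hclamp : ∀ (f : X.Elem) (k : ℕ), ∃ y : X.Elem,
      X.toAE y =ᵐ[μ] fun ω => max (-s k ω) (min (X.toAE f ω) (s k ω)) := by
    intro f k
    refine exists_elem_of_ae_le
      ((hsm k).neg.max ((measurable_toAE f).min (hsm k))).aemeasurable (e k) ?_
    filter_upwards [he k] with ω h
    rw [h, abs_of_nonneg (hs0 k ω)]
    exact habs _ _ (hs0 k ω)
  choose c hc using hclamp
  refine ⟨range fun p : ℕ × ℕ => c (d p.1) p.2, countable_range _, fun f => ?_⟩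
  obtain ⟨j, hj⟩ := exists_seq_ae_tendsto_of_localMeasure hC.1.1 (hd f)
  have hlim : ∀ᵐ ω ∂μ, Tendsto (fun n => X.toAE (d (j n)) ω) atTop (𝓝 (X.toAE f ω)) := by
    filter_upwards [hj, hC.1.2 _ (toAE_mem f), ae_all_iff.2 fun n => hC.1.2 _ (toAE_mem (d n))]
      with ω h1 h2 h3
    by_cases hω : ω ∈ C
    · exact h1 hω
    · simp only [h2 hω, h3 _ hω, tendsto_const_nhds]
  have hinner : ∀ k, c f k ∈ closure (range fun p : ℕ × ℕ => c (d p.1) p.2) := by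
    intro k
    refine mem_closure_of_tendsto (b := atTop) (f := fun n => c (d (j n)) k)
      (hX.tendsto_of_dominated (g := (2 : ℝ) • e k) (fun n => ?_) ?_)
      (.of_forall fun n => ⟨(j n, k), rfl⟩)
    · filter_upwards [hc (d (j n)) k, hc f k, coeFn_smul 2 (e k), he k] with ω h1 h2 h3 h4
      rw [h1, h2, h3, h4, abs_of_nonneg (mul_nonneg zero_le_two (hs0 k ω)), two_mul]
      exact (abs_sub _ _).trans (add_le_add (habs _ _ (hs0 k ω)) (habs _ _ (hs0 k ω)))
    · filter_upwards [ae_all_iff.2 fun n => hc (d (j n)) k, hc f k, hlim] with ω h1 h2 h3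
      simp only [h1, h2]
      exact tendsto_const_nhds.max (h3.min tendsto_const_nhds)
  refine closure_closure.subset (mem_closure_of_tendsto (b := atTop) (f := c f)
    (hX.tendsto_of_dominated (g := f) (fun k => ?_) ?_) (.of_forall hinner))
  -- Truncation moves $f$ towards 0 without changing its sign, so the error is at most $|f|$.
  · filter_upwards [hc f k] with ω h1
    rw [h1]
    have := hs0 k ω
    rcases le_total (X.toAE f ω) (s k ω) with h | h
    · rw [min_eq_left h]
      rcases le_total (-s k ω) (X.toAE f ω) with h' | h'
      · rw [max_eq_right h', sub_self, abs_zero]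
        exact abs_nonneg _
      · rw [max_eq_left h', abs_of_nonneg (by linarith), abs_of_nonpos (by linarith)]
        linarith
    · rw [min_eq_right h, max_eq_right (by linarith), abs_of_nonpos (by linarith),
        abs_of_nonneg (by linarith)]
      linarith
  · filter_upwards [ae_all_iff.2 fun k => hc f k, hlim] with ω h1 h2
    refine tendsto_const_nhds.congr' ?_
    have hev : ∀ᶠ k : ℕ in atTop, |X.toAE f ω| ≤ s k ω := by
      -- Where all $d_i$ vanish, $f$ is a limit of zeros and needs no room.
      by_cases h0 : ∀ i, X.toAE (d i) ω = 0
      · simp only [h0] at h2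
        rw [← tendsto_nhds_unique tendsto_const_nhds h2, abs_zero]
        exact .of_forall fun k => hs0 k ω
      · obtain ⟨i, hi⟩ := not_forall.1 h0
        have hpos : 0 < |X.toAE (d i) ω| := abs_pos.2 hi
        obtain ⟨N, hN⟩ := exists_nat_ge (|X.toAE f ω| / |X.toAE (d i) ω|)
        filter_upwards [eventually_ge_atTop N, eventually_gt_atTop i] with k hk hk'
        calc |X.toAE f ω| ≤ N * |X.toAE (d i) ω| := (div_le_iff₀ hpos).1 hN
          _ ≤ k * |X.toAE (d i) ω| := by gcongr
          _ ≤ s k ω := mul_le_mul_of_nonneg_left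
            (Finset.single_le_sum (f := fun i => |X.toAE (d i) ω|) (fun _ _ => abs_nonneg _)
              (Finset.mem_range.2 hk')) k.cast_nonneg
    filter_upwards [hev] with k hk
    rw [h1, min_eq_left (abs_le.1 hk).2, max_eq_right (abs_le.1 hk).1]

/-- A norm separable order continuous space has a `σ`-finite carrier. -/
theorem exists_isCarrier_sigmaFinite (hμ : IsSemifiniteMeasure μ) (hX : X.IsOrderContinuous)
    [SeparableSpace X.Elem] : ∃ C : Set Ω, X.IsCarrier C ∧ SigmaFinite (μ.restrict C) := by
  have hC := isCarrier_iUnion_support (denseRange_denseSeq X.Elem)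
  refine ⟨_, hC, ?_⟩
  choose A hAm hA hcov using fun n => hX.exists_finite_cover_support hμ (denseSeq X.Elem n)
  set U := ⋃ n, ⋃ k, A n k with hU
  have hUm : MeasurableSet U := .iUnion fun n => .iUnion fun k => hAm n k
  -- The complement of the covering sets meets the carrier in a null set, so it may be added to
  -- cover all of $\Omega$.
  refine Measure.sigmaFinite_of_countable
    (S := insert Uᶜ (range fun p : ℕ × ℕ => A p.1 p.2)) ((countable_range _).insert _) ?_ ?_
  · rintro _ (rfl | ⟨p, rfl⟩)
    · refine lt_of_le_of_lt (le_of_eq ?_) ENNReal.zero_lt_top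
      rw [Measure.restrict_apply hUm.compl]
      refine measure_mono_null ?_ (ae_all_iff.2 hcov)
      rintro ω ⟨h1, h2⟩ h3
      obtain ⟨n, hn⟩ := mem_iUnion.1 h2
      exact h1 (mem_iUnion_of_mem n (h3 n hn))
    · exact (Measure.restrict_apply_le _ _).trans_lt (hA p.1 p.2)
  · refine eq_univ_of_forall fun ω => ?_
    by_cases h : ω ∈ U
    · obtain ⟨n, hn⟩ := mem_iUnion.1 h
      obtain ⟨k, hk⟩ := mem_iUnion.1 hn
      exact ⟨_, .inr ⟨(n, k), rfl⟩, hk⟩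
    · exact ⟨_, .inl rfl, h⟩

end NormedFunctionSpace

theorem mainTheorem3 {Ω : Type u} [MeasurableSpace Ω] (μ : Measure Ω)
    (hμ : IsSemifiniteMeasure μ) (X : BanachFunctionSpace μ) (hX : X.IsOrderContinuous) :
    SeparableSpace X.Elem ↔
      (∃ C : Set Ω, X.IsCarrier C ∧ SigmaFinite (μ.restrict C)) ∧
        @SeparableSpace X.toSubmodule X.localMeasureTopology :=
  ⟨fun _ => ⟨NormedFunctionSpace.exists_isCarrier_sigmaFinite hμ hX,
    NormedFunctionSpace.separableSpace_localMeasure X.complete⟩,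
    fun ⟨⟨_, hC, _⟩, h⟩ => NormedFunctionSpace.separableSpace_of_localMeasure hX hC h⟩
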